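/- Topological groups are not assumed to be Hausdorff (or abelian). A continuous homomorphism $f\colon G\to H$ of topological groups is called \emph{c-closed} if $f(A)$ is closed in $H$ for every closed subgroup $A\le G$. It is called \emph{c-proper} if for every topological group $K$ and every continuous homomorphism $g\colon K\to H$ the projection $p_2\colon G\times_H K=\{(x,y)\in G\times K : f(x)=g(y)\}\to K$, $(x,y)\mapsto y$, is c-closed, where $G\times_H K$ carries the subspace topology of the product $G\times K$. Let $(f_i\colon G_i\to H_i)_{i\in I}$ be an arbitrary family of c-proper continuous homomorphisms of topological groups, indexed by a set $I$. Then the product homomorphism $\prod_{i\in I} f_i\colon \prod_{i\in I} G_i\to\prod_{i\in I} H_i$, with respect to the product topologies, is c-proper. -/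

import Mathlib

universe u

namespace TopGrp

/-- A continuous homomorphism is c-closed if it maps closed subgroups onto closed subgroups. -/
def CClosed {G H : Type u} [Group G] [TopologicalSpace G] [Group H] [TopologicalSpace H]
    (f : G →ₜ* H) : Prop :=
  ∀ A : Subgroup G, IsClosed (A : Set G) → IsClosed (A.map f.toMonoidHom : Set H)

/-- The pullback `G ×_H K = {(x, y) | f x = g y}` of `f : G → H` and `g : K → H`, as a subgroup of
`G × K`; its coercion to a type carries the subspace topology of the product topology. -/
def pullback {G H K : Type u} [Group G] [TopologicalSpace G] [Group H] [TopologicalSpace H]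
    [Group K] [TopologicalSpace K] (f : G →ₜ* H) (g : K →ₜ* H) : Subgroup (G × K) :=
  (f.toMonoidHom.comp (MonoidHom.fst G K)).eqLocus (g.toMonoidHom.comp (MonoidHom.snd G K))

/-- The second projection `p₂ : G ×_H K → K` of the pullback. -/
def pullbackSnd {G H K : Type u} [Group G] [TopologicalSpace G] [Group H] [TopologicalSpace H]
    [Group K] [TopologicalSpace K] (f : G →ₜ* H) (g : K →ₜ* H) : pullback f g →ₜ* K where
  toMonoidHom := (MonoidHom.snd G K).comp (pullback f g).subtype
  continuous_toFun := continuous_snd.comp continuous_subtype_val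

/-- A continuous homomorphism `f : G → H` is c-proper if it is stably c-closed: its pullback
`p₂ : G ×_H K → K` along every continuous homomorphism `g : K → H` from a topological group `K`
is c-closed. -/
def CProper {G H : Type u} [Group G] [TopologicalSpace G] [Group H] [TopologicalSpace H]
    (f : G →ₜ* H) : Prop :=
  ∀ (K : Type u) [Group K] [TopologicalSpace K] [IsTopologicalGroup K] (g : K →ₜ* H),
    CClosed (pullbackSnd f g)

/-- The product `∏ f i : ∏ G i → ∏ H i` of a family of continuous homomorphisms, between the
product groups with the product topologies. -/
def piMap {ι : Type u} {G H : ι → Type u}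
    [∀ i, Group (G i)] [∀ i, TopologicalSpace (G i)]
    [∀ i, Group (H i)] [∀ i, TopologicalSpace (H i)]
    (f : ∀ i, G i →ₜ* H i) : (∀ i, G i) →ₜ* (∀ i, H i) where
  toMonoidHom := MonoidHom.piMap fun i => (f i).toMonoidHom
  continuous_toFun := continuous_pi fun i => (f i).continuous_toFun.comp (continuous_apply i)

end TopGrp

/-! A Tychonoff-style argument by Zorn's lemma. For `y` adherent to the projection of a closed
subgroup `A`, order by extension the partial points `(J, x)` of the fibre over `y` that are adherent
to the image of `A`. Chains are bounded because basic neighbourhoods in a product involve finitely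
many coordinates (`exists_isPartialLift_upperBound`), and c-properness of `f i` adds a coordinate
`i` (`IsPartialLift.exists_insert`). A maximal `J` is thus everything, and closedness of `A`
finishes. -/

namespace TopGrp

section Topology

variable {ι K : Type*} {G : ι → Type*} [∀ i, TopologicalSpace (G i)] [TopologicalSpace K]

/-- Restrict the first component of a point of `(∀ i, G i) × K` to the coordinates in `J`. -/
def restrictFst (J : Set ι) (p : (∀ i, G i) × K) : (∀ i : J, G i) × K :=
  (fun i => p.1 i, p.2)

/-- Adherence to the image of a set in `(∀ i : J, G i) × K` passes to smaller sets of
coordinates. -/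
lemma mem_closure_restrictFst_mono {S : Set ((∀ i, G i) × K)} {I J : Set ι} (hIJ : I ⊆ J)
    {p : (∀ i, G i) × K} (hp : restrictFst J p ∈ closure (restrictFst J '' S)) :
    restrictFst I p ∈ closure (restrictFst I '' S) := by
  let r : (∀ i : J, G i) × K → (∀ i : I, G i) × K := fun q => (fun i => q.1 ⟨i, hIJ i.2⟩, q.2)
  have hr : Continuous r := by fun_prop
  have h := image_closure_subset_closure_image hr (Set.mem_image_of_mem r hp)
  rwa [Set.image_image] at h

/-- Adherence to the image of a set in `(∀ i : J, G i) × K` can be tested on finite subsets of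
`J`. -/
lemma mem_closure_restrictFst_of_finite {S : Set ((∀ i, G i) × K)} {J : Set ι}
    {p : (∀ i, G i) × K}
    (hp : ∀ F : Set ι, F.Finite → F ⊆ J → restrictFst F p ∈ closure (restrictFst F '' S)) :
    restrictFst J p ∈ closure (restrictFst J '' S) := by
  rw [mem_closure_iff_nhds]
  intro t ht
  obtain ⟨u, hu, v, hv, huv⟩ := mem_nhds_prod_iff.1 ht
  rw [nhds_pi, Filter.mem_pi] at hu
  obtain ⟨I, hI, w, hw, hwu⟩ := hu
  have hFJ : Subtype.val '' I ⊆ J := by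
    rintro _ ⟨i, -, rfl⟩
    exact i.2
  have hF := hp (Subtype.val '' I) (hI.image _) hFJ
  rw [mem_closure_iff_nhds] at hF
  have : Finite (Subtype.val '' I : Set ι) := hI.image _
  obtain ⟨_, hq, ⟨a, haS, rfl⟩⟩ :=
    hF (Set.pi Set.univ (fun i : (Subtype.val '' I : Set ι) => w ⟨i, hFJ i.2⟩) ×ˢ v)
      (prod_mem_nhds (set_pi_mem_nhds Set.finite_univ fun i _ => hw ⟨i, hFJ i.2⟩) hv)
  exact ⟨restrictFst J a,
    huv ⟨hwu fun i hi => hq.1 ⟨i.1, i, hi, rfl⟩ trivial, hq.2⟩, a, haS, rfl⟩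

end Topology

variable {ι : Type u} {G H : ι → Type u}
  [∀ i, Group (G i)] [∀ i, TopologicalSpace (G i)]
  [∀ i, Group (H i)] [∀ i, TopologicalSpace (H i)]
  {K : Type u} [Group K] [TopologicalSpace K]

/-- The pairs `(J, x)` such that `x`, restricted to `J`, is a partial point of the fibre over `y`
that is adherent to the image of `S`. -/
def IsPartialLift (f : ∀ i, G i →ₜ* H i) (g : K →ₜ* (∀ i, H i)) (S : Set ((∀ i, G i) × K)) (y : K)
    (q : Set ι × (∀ i, G i)) : Prop :=
  (∀ i ∈ q.1, f i (q.2 i) = g y i) ∧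
    restrictFst q.1 (q.2, y) ∈ closure (restrictFst q.1 '' S)

/-- A partial lift extends to any further coordinate `i` for which `f i` is c-proper. -/
lemma IsPartialLift.exists_insert [∀ i, IsTopologicalGroup (G i)] [IsTopologicalGroup K]
    {f : ∀ i, G i →ₜ* H i} {g : K →ₜ* (∀ i, H i)} {A : Subgroup (pullback (piMap f) g)} {y : K}
    {J : Set ι} {x : ∀ i, G i}
    (hx : IsPartialLift f g (Subtype.val '' (A : Set (pullback (piMap f) g))) y (J, x))
    {i : ι} (hi : i ∉ J) (hfi : CProper (f i)) :
    ∃ x' : ∀ i, G i, (∀ j ∈ J, x j = x' j) ∧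
      IsPartialLift f g (Subtype.val '' (A : Set (pullback (piMap f) g))) y (insert i J, x') := by
  classical
  -- The base change of `f i` is taken along a map from `(∀ j : J, G j) × K`, not from `K`, so that
  -- the lift found keeps the coordinates in `J`.
  let g' : ((∀ j : J, G j) × K) →ₜ* H i :=
    { toMonoidHom := ((Pi.evalMonoidHom H i).comp g.toMonoidHom).comp (MonoidHom.snd _ K)
      continuous_toFun := (continuous_apply i).comp (g.continuous_toFun.comp continuous_snd) }
  let φ : pullback (piMap f) g →* pullback (f i) g' :=
    { toFun := fun a => ⟨(a.1.1 i, restrictFst J a.1), congrFun a.2 i⟩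
      map_one' := rfl
      map_mul' := fun _ _ => rfl }
  have hB := hfi _ g' (A.map φ).topologicalClosure (A.map φ).isClosed_topologicalClosure
  have hsub : restrictFst J '' (Subtype.val '' (A : Set (pullback (piMap f) g))) ⊆
      ((A.map φ).topologicalClosure.map (pullbackSnd (f i) g').toMonoidHom : Set _) := by
    rintro _ ⟨_, ⟨a, ha, rfl⟩, rfl⟩
    exact ⟨φ a, (A.map φ).le_topologicalClosure ⟨a, ha, rfl⟩, rfl⟩
  obtain ⟨⟨⟨t, z⟩, htz⟩, hmem, hz⟩ := closure_minimal hsub hB hx.2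
  obtain rfl : z = restrictFst J (x, y) := hz
  have hne : ∀ j ∈ J, j ≠ i := fun j hj h => hi (h ▸ hj)
  refine ⟨Function.update x i t, fun j hj => (Function.update_of_ne (hne j hj) _ _).symm, ?_, ?_⟩
  · rintro j (rfl | hj)
    · have h : f j t = g y j := htz
      simpa using h
    · simpa [Function.update_of_ne (hne j hj)] using hx.1 j hj
  -- Gluing the new coordinate to the old ones is continuous, so it carries adherence over.
  · let ψ : pullback (f i) g' → (∀ j : (insert i J : Set ι), G j) × K := fun q =>
      (fun j => if h : j.1 = i then h.symm.rec (motive := fun k _ => G k) q.1.1 else q.1.2.1 ⟨j, j.2.resolve_left h⟩, q.1.2.2)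
    have hψ : Continuous ψ := by
      refine Continuous.prodMk (continuous_pi ?_) (by fun_prop)
      rintro ⟨j, hj⟩
      by_cases h : j = i
      · subst h
        simpa using (by fun_prop : Continuous fun q : pullback (f j) g' => q.1.1)
      · simp only [h, dite_false]
        fun_prop
    have hψφ : ∀ a : pullback (piMap f) g, ψ (φ a) = restrictFst (insert i J) a.1 := by
      intro a
      refine Prod.ext (funext ?_) rfl
      rintro ⟨j, hj⟩
      by_cases h : j = i
      · subst h
        simp [ψ, φ, restrictFst]
      · simp [ψ, φ, restrictFst, h]
    have h := image_closure_subset_closure_image hψ (Set.mem_image_of_mem ψ hmem)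
    have hset : ψ '' (A.map φ : Set _) =
        restrictFst (insert i J) '' (Subtype.val '' (A : Set (pullback (piMap f) g))) := by
      rw [Subgroup.coe_map, Set.image_image, Set.image_image]
      exact Set.image_congr fun a _ => hψφ a
    rw [hset] at h
    convert h using 1
    refine Prod.ext (funext ?_) rfl
    rintro ⟨j, hj⟩
    by_cases h : j = i
    · subst h
      simp [ψ, restrictFst]
    · simp [ψ, restrictFst, h]

/-- A chain of partial lifts, ordered by extension, has an upper bound. -/
lemma exists_isPartialLift_upperBound {f : ∀ i, G i →ₜ* H i} {g : K →ₜ* (∀ i, H i)}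
    {S : Set ((∀ i, G i) × K)} {y : K} (hy : y ∈ closure (Prod.snd '' S))
    {c : Set (Set ι × (∀ i, G i))} (hc : ∀ q ∈ c, IsPartialLift f g S y q)
    (hchain : ∀ p ∈ c, ∀ q ∈ c, (p.1 ⊆ q.1 ∧ ∀ i ∈ p.1, p.2 i = q.2 i) ∨
      (q.1 ⊆ p.1 ∧ ∀ i ∈ q.1, q.2 i = p.2 i)) :
    ∃ q, IsPartialLift f g S y q ∧ ∀ p ∈ c, p.1 ⊆ q.1 ∧ ∀ i ∈ p.1, p.2 i = q.2 i := by
  classical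
  let x : ∀ i, G i := fun i => if h : ∃ q ∈ c, i ∈ q.1 then h.choose.2 i else 1
  have hx : ∀ p ∈ c, ∀ i ∈ p.1, p.2 i = x i := by
    intro p hp i hi
    have h : ∃ q ∈ c, i ∈ q.1 := ⟨p, hp, hi⟩
    have hxi : x i = h.choose.2 i := dif_pos h
    rw [hxi]
    obtain h' | h' := hchain p hp _ h.choose_spec.1
    · exact h'.2 i hi
    · exact (h'.2 i h.choose_spec.2).symm
  refine ⟨(⋃ q ∈ c, q.1, x), ⟨?_, ?_⟩, fun p hp => ⟨Set.subset_biUnion_of_mem hp, hx p hp⟩⟩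
  · intro i hi
    obtain ⟨q, hq, hiq⟩ := Set.mem_iUnion₂.1 hi
    have h := (hc q hq).1 i hiq
    rwa [hx q hq i hiq] at h
  · refine mem_closure_restrictFst_of_finite fun F hF hFc => ?_
    -- Only the empty chain needs `hy`: it gives the starting lift with no coordinates.
    obtain rfl | hne := c.eq_empty_or_nonempty
    · obtain rfl : F = ∅ := by simpa using hFc
      have hι : Continuous fun k : K => restrictFst (∅ : Set ι) (x, k) := by
        unfold restrictFst
        fun_prop
      have h := image_closure_subset_closure_image hι (Set.mem_image_of_mem _ hy)
      rw [Set.image_image] at h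
      convert h using 2
      exact Set.image_congr fun a _ => Prod.ext (Subsingleton.elim _ _) rfl
    · have hdir : DirectedOn (· ⊆ ·) (Prod.fst '' c) := by
        rintro _ ⟨p, hp, rfl⟩ _ ⟨q, hq, rfl⟩
        obtain h | h := hchain p hp q hq
        · exact ⟨q.1, ⟨q, hq, rfl⟩, h.1, subset_rfl⟩
        · exact ⟨p.1, ⟨p, hp, rfl⟩, subset_rfl, h.1⟩
      obtain ⟨_, ⟨q, hq, rfl⟩, hFq⟩ :=
        hdir.exists_mem_subset_of_finite_of_subset_sUnion (hne.image _) hF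
          (by rwa [Set.sUnion_image])
      have h := mem_closure_restrictFst_mono hFq (hc q hq).2
      convert h using 1
      exact Prod.ext (funext fun i => (hx q hq i (hFq i.2)).symm) rfl

end TopGrp

theorem corollary5p2 {ι : Type u} {G H : ι → Type u}
    [∀ i, Group (G i)] [∀ i, TopologicalSpace (G i)] [∀ i, IsTopologicalGroup (G i)]
    [∀ i, Group (H i)] [∀ i, TopologicalSpace (H i)] [∀ i, IsTopologicalGroup (H i)]
    (f : ∀ i, G i →ₜ* H i) (hf : ∀ i, TopGrp.CProper (f i)) :
    TopGrp.CProper (TopGrp.piMap f) := by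
  intro K _ _ _ g A hA
  refine isClosed_of_closure_subset fun y hy => ?_
  let S : Set ((∀ i, G i) × K) := Subtype.val '' (A : Set (TopGrp.pullback (TopGrp.piMap f) g))
  have hyS : y ∈ closure (Prod.snd '' S) := by
    rw [Set.image_image]
    exact hy
  -- Not antisymmetric, since values of `x` off `J` are ignored; transitivity suffices for Zorn.
  let r : {q // TopGrp.IsPartialLift f g S y q} → {q // TopGrp.IsPartialLift f g S y q} → Prop :=
    fun p q => p.1.1 ⊆ q.1.1 ∧ ∀ i ∈ p.1.1, p.1.2 i = q.1.2 i
  obtain ⟨⟨⟨J, x⟩, hx⟩, hmax⟩ := exists_maximal_of_chains_bounded (r := r)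
    (fun c hc => by
      obtain ⟨q, hq, hqc⟩ := TopGrp.exists_isPartialLift_upperBound (c := Subtype.val '' c) hyS
        (by rintro _ ⟨q, -, rfl⟩; exact q.2)
        (by
          rintro _ ⟨p, hp, rfl⟩ _ ⟨q, hq, rfl⟩
          obtain rfl | hne := eq_or_ne p q
          · exact Or.inl ⟨subset_rfl, fun _ _ => rfl⟩
          · exact hc hp hq hne)
      exact ⟨⟨q, hq⟩, fun p hp => hqc p.1 ⟨p, hp, rfl⟩⟩)
    (fun {p q s} hpq hqs =>
      ⟨hpq.1.trans hqs.1, fun i hi => (hpq.2 i hi).trans (hqs.2 i (hpq.1 hi))⟩)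
  have hJ : J = Set.univ := by
    refine Set.eq_univ_of_forall fun i => by_contra fun hi => ?_
    obtain ⟨x', hxx', hx'⟩ := hx.exists_insert hi (hf i)
    exact hi ((hmax ⟨_, hx'⟩ ⟨Set.subset_insert i J, hxx'⟩).1 (Set.mem_insert i J))
  subst hJ
  have hmem : (x, y) ∈ TopGrp.pullback (TopGrp.piMap f) g :=
    funext fun i => hx.1 i trivial
  let e : (∀ i : (Set.univ : Set ι), G i) × K → (∀ i, G i) × K :=
    fun q => (fun i => q.1 ⟨i, trivial⟩, q.2)
  have he : Continuous e := by fun_prop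
  have hcl : (x, y) ∈ closure S := by
    have h := image_closure_subset_closure_image he (Set.mem_image_of_mem e hx.2)
    rw [Set.image_image] at h
    simpa [e, TopGrp.restrictFst] using h
  -- `A` is closed only in the pullback, hence the need for `hmem`.
  have hxA : (⟨(x, y), hmem⟩ : TopGrp.pullback (TopGrp.piMap f) g) ∈ A := by
    rw [← SetLike.mem_coe, ← hA.closure_eq, closure_subtype]
    exact hcl
  exact ⟨_, hxA, rfl⟩
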